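/- Let $f,g:\mathbb R^d\to\mathbb R^d$ with $f$ continuous, let $B=(B(t))_{t\ge 0}$ be a scalar standard Brownian motion on a probability space $(\Omega,\mathcal F,\mathbb P)$, let $\theta\in[1/2,1]$, and let $h>0$ be any step size. Assume that there are constants $K_1>0$, $K_2<0$, $\mu<0$ and $a,\sigma,b>0$ with $$2K_2+K_1<0,\qquad 2\mu+\sigma<0,$$ such that for all $x,y\in\mathbb R^d$ $$\langle x-y,\,f(x)-f(y)\rangle\le K_2|x-y|^2,\qquad |g(x)-g(y)|^2\le K_1|x-y|^2,$$ $$\langle x,f(x)\rangle\le\mu|x|^2+a,\qquad |g(x)|^2\le\sigma|x|^2+b.$$ (No global Lipschitz or linear growth condition is imposed on $f$, so super-linear drift is allowed.) Consider the stochastic theta method for $dx(t)=f(x(t))\,dt+g(x(t))\,dB(t)$, $$X_{k+1}=X_k+\theta f(X_{k+1})h+(1-\theta)f(X_k)h+g(X_k)\,\Delta B_k,\qquad X_0=x_0,\qquad \Delta B_k=B((k+1)h)-B(kh),\quad k\ge 0.$$ Then for every $x_0\in\mathbb R^d$ this implicit scheme has an almost surely unique solution $(X_k^{x_0})_{k\ge0}$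 (consisting of random variables), and it has a unique stationary distribution: there is exactly one probability measure $\Pi_h$ on $\mathbb R^d$ such that for every $x_0\in\mathbb R^d$ the law of $X_k^{x_0}$ converges weakly to $\Pi_h$ as $k\to\infty$, i.e. $$\lim_{k\to\infty}\ \sup_{F\in\mathbb L}\Big|\mathbb E\,F(X_k^{x_0})-\int_{\mathbb R^d}F(y)\,\Pi_h(dy)\Big|=0,$$ where $\mathbb L$ is the set of all $F:\mathbb R^d\to\mathbb R$ with $|F(x)-F(y)|\le|x-y|$ and $|F(x)|\le1$ for all $x,y\in\mathbb R^d$. -/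

import Mathlib

open MeasureTheory ProbabilityTheory Filter Topology
open scoped NNReal

/-- `X` is a solution of the stochastic theta method with step size `h` for
`dx = f(x) dt + g(x) dB`, started at `x₀`: almost surely `X 0 = x₀` and, for every `k`,
`X (k+1) = X k + θ f(X (k+1)) h + (1 - θ) f(X k) h + g(X k) (B((k+1)h) - B(kh))`. -/
def IsThetaScheme {d : ℕ} {Ω : Type*} [MeasurableSpace Ω] (P : Measure Ω) (B : ℝ≥0 → Ω → ℝ)
    (f g : EuclideanSpace ℝ (Fin d) → EuclideanSpace ℝ (Fin d)) (θ : ℝ) (h : ℝ≥0)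
    (x₀ : EuclideanSpace ℝ (Fin d)) (X : ℕ → Ω → EuclideanSpace ℝ (Fin d)) : Prop :=
  ∀ᵐ ω ∂P, X 0 ω = x₀ ∧ ∀ k : ℕ,
    X (k + 1) ω = X k ω + (θ * (h : ℝ)) • f (X (k + 1) ω) + ((1 - θ) * (h : ℝ)) • f (X k ω)
      + (B (((k : ℝ≥0) + 1) * h) ω - B ((k : ℝ≥0) * h) ω) • g (X k ω)

/-- The test functions of the metric `distL`: `|F x - F y| ≤ |x - y|` and `|F x| ≤ 1`. -/
def testL (d : ℕ) : Set (EuclideanSpace ℝ (Fin d) → ℝ) :=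
  {F | (∀ x y, |F x - F y| ≤ ‖x - y‖) ∧ ∀ x, |F x| ≤ 1}

/-- The metric `sup_{F ∈ L} |∫ F dμ - ∫ F dν|` for the weak convergence of probability measures. -/
noncomputable def distL {d : ℕ} (μ ν : Measure (EuclideanSpace ℝ (Fin d))) : ℝ :=
  ⨆ F : testL d, |(∫ x, F.1 x ∂μ) - ∫ x, F.1 x ∂ν|

/-- `π` is a stationary distribution of the stochastic theta method: for every initial value,
the law of the `k`-th iterate, i.e. the `k`-step transition probability from that initial value,
converges weakly to `π`. -/
def IsStationaryDistribution {d : ℕ} {Ω : Type*} [MeasurableSpace Ω] (P : Measure Ω)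
    (B : ℝ≥0 → Ω → ℝ) (f g : EuclideanSpace ℝ (Fin d) → EuclideanSpace ℝ (Fin d)) (θ : ℝ)
    (h : ℝ≥0) (π : ProbabilityMeasure (EuclideanSpace ℝ (Fin d))) : Prop :=
  ∀ (x₀ : EuclideanSpace ℝ (Fin d)) (X : ℕ → Ω → EuclideanSpace ℝ (Fin d)),
    IsThetaScheme P B f g θ h x₀ X →
      Tendsto (fun k => distL (P.map (X k)) (π : Measure (EuclideanSpace ℝ (Fin d))))
        atTop (𝓝 0)

/-!
# Stationary distribution of the stochastic theta method

Put `G x = x - θ h f x`. The implicit step reads `G X' = X + (1 - θ) h f X + ΔB g X`. One-sided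
dissipativity of `f` makes `G` continuous and strongly monotone, hence a homeomorphism of `ℝᵈ`
(`exists_homeomorph_of_strongly_monotone`), so the scheme is the random iteration `X' = T X ΔB` of a
continuous map `T` driven by independent Gaussian increments, and is solved uniquely.

The energy is measured by `‖G x‖²` rather than `‖x‖²`. Expanding the square, and using
`(1 - 2θ) h² ‖f x‖² ≤ 0`, gives for one step

* `E ‖G X'‖² + h |2μ + σ| ‖X‖² ≤ ‖G X‖² + h (2a + b)` for one trajectory, and
* `E ‖G X' - G Y'‖² + h |2K₂ + K₁| ‖X - Y‖² ≤ ‖G X - G Y‖²` for two trajectories on the same noise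

(`lintegral_norm_sq_step_add_le`). When `θ = 1 / 2` neither inequality is a geometric contraction,
so only their sums over time are used. The first bounds the time averages of `E ‖X k‖²`; by
Prokhorov's theorem the time averages of the laws have a limit point, and it is invariant
(`exists_invariant_measure_of_second_moment`). The second makes `∑ E ‖X k - Y k‖²` finite, so that
`E ‖X k - Y k‖²` tends to `0`. Starting `Y` from the invariant law `π` keeps its law equal to `π`,
and dominated convergence over the initial value of `Y` shows that the law of `X k` converges to `π`
(`tendsto_distL_randIter`). Bounded Lipschitz functions separate measures, whence uniqueness
(`eq_of_tendsto_distL`).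
-/

/-! ### Strongly monotone maps -/

/-- A continuous strongly monotone map of `ℝⁿ` is onto. The proof is by induction on the dimension:
for each value `t` of the first coordinate the remaining equations have a solution `ξ t`, which
depends continuously on `t`, and the first equation along this curve is solved by the intermediate
value theorem, being itself strongly monotone in `t`. -/
theorem surjective_of_strongly_monotone_pi : ∀ (n : ℕ) (F : (Fin n → ℝ) → Fin n → ℝ),
    Continuous F → (∀ x y, ∑ i, (x i - y i) ^ 2 ≤ ∑ i, (x i - y i) * (F x i - F y i)) →
    Function.Surjective F
  | 0, _, _, _ => fun _ => ⟨0, Subsingleton.elim _ _⟩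
  | n + 1, F, hF, hmono => by
    intro y
    have hsol : ∀ t : ℝ, ∃ x : Fin n → ℝ,
        (fun i : Fin n => F (Fin.cons t x) i.succ) = fun i : Fin n => y i.succ := by
      intro t
      refine surjective_of_strongly_monotone_pi n
        (fun x i => F (Fin.cons t x) i.succ) ?_ ?_ _
      · have : Continuous fun x : Fin n → ℝ => (Fin.cons t x : Fin (n + 1) → ℝ) :=
          Continuous.finCons continuous_const continuous_id
        fun_prop
      · intro u v
        simpa [Fin.sum_univ_succ] using hmono (Fin.cons t u) (Fin.cons t v)
    choose ξ hξ using hsol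
    have hξ' : ∀ t i, F (Fin.cons t (ξ t)) (Fin.succ i) = y i.succ := fun t i => congrFun (hξ t) i
    have hdiff : ∀ t s, ∑ i, (ξ t i - ξ s i) ^ 2 ≤
        ∑ i : Fin n, (y i.succ - F (Fin.cons t (ξ s)) i.succ) ^ 2 := by
      intro t s
      have h1 := hmono (Fin.cons t (ξ t)) (Fin.cons t (ξ s))
      simp only [Fin.sum_univ_succ, Fin.cons_zero, Fin.cons_succ, sub_self, hξ'] at h1
      have h2 : ∑ i, (ξ t i - ξ s i) * (y i.succ - F (Fin.cons t (ξ s)) i.succ) ≤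
          ∑ i, (1 / 2 * (ξ t i - ξ s i) ^ 2
            + 1 / 2 * (y i.succ - F (Fin.cons t (ξ s)) i.succ) ^ 2) :=
        Finset.sum_le_sum fun i _ => by
          nlinarith [sq_nonneg ((ξ t i - ξ s i) - (y i.succ - F (Fin.cons t (ξ s)) i.succ))]
      rw [Finset.sum_add_distrib, ← Finset.mul_sum, ← Finset.mul_sum] at h2
      simp only [ne_eq, OfNat.ofNat_ne_zero, not_false_eq_true, zero_pow, zero_mul, zero_add] at h1
      linarith
    have hξc : Continuous ξ := by
      refine continuous_iff_continuousAt.2 fun s => tendsto_pi_nhds.2 fun i => ?_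
      have hE : Tendsto (fun t => √(∑ j : Fin n, (y j.succ - F (Fin.cons t (ξ s)) j.succ) ^ 2))
          (𝓝 s) (𝓝 0) := by
        have hc : Continuous fun t : ℝ => (Fin.cons t (ξ s) : Fin (n + 1) → ℝ) :=
          Continuous.finCons continuous_id continuous_const
        have : Continuous
            fun t => √(∑ j : Fin n, (y j.succ - F (Fin.cons t (ξ s)) j.succ) ^ 2) := by
          fun_prop
        simpa [hξ'] using this.tendsto s
      refine tendsto_iff_dist_tendsto_zero.2 (squeeze_zero (fun _ => dist_nonneg) (fun t => ?_) hE)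
      rw [Real.dist_eq]
      refine Real.le_sqrt_of_sq_le ?_
      rw [sq_abs]
      exact (Finset.single_le_sum (f := fun j => (ξ t j - ξ s j) ^ 2)
        (fun j _ => sq_nonneg _) (Finset.mem_univ i)).trans (hdiff t s)
    have hφc : Continuous fun t => F (Fin.cons t (ξ t)) 0 := by
      have : Continuous fun t : ℝ => (Fin.cons t (ξ t) : Fin (n + 1) → ℝ) :=
        Continuous.finCons continuous_id hξc
      fun_prop
    have hφ : ∀ t s, (t - s) ^ 2 ≤
        (t - s) * (F (Fin.cons t (ξ t)) 0 - F (Fin.cons s (ξ s)) 0) := by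
      intro t s
      have h1 := hmono (Fin.cons t (ξ t)) (Fin.cons s (ξ s))
      simp only [Fin.sum_univ_succ, Fin.cons_zero, Fin.cons_succ, hξ', sub_self, mul_zero,
        Finset.sum_const_zero, add_zero] at h1
      have h2 : 0 ≤ ∑ i, (ξ t i - ξ s i) ^ 2 := Finset.sum_nonneg fun _ _ => sq_nonneg _
      linarith
    obtain ⟨t, ht⟩ : ∃ t, F (Fin.cons t (ξ t)) 0 = y 0 := by
      refine hφc.surjective ?_ ?_ (y 0)
      · refine tendsto_atTop_mono' atTop ?_
          (tendsto_atTop_add_const_right _ (F (Fin.cons 0 (ξ 0)) 0) tendsto_id)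
        filter_upwards [eventually_gt_atTop 0] with t ht
        have := hφ t 0
        simp only [sub_zero, sq] at this
        have := le_of_mul_le_mul_left this ht
        simp only [id]; linarith
      · refine tendsto_atBot_mono' atBot ?_
          (tendsto_atBot_add_const_right _ (F (Fin.cons 0 (ξ 0)) 0) tendsto_id)
        filter_upwards [eventually_lt_atBot 0] with t ht
        have := hφ t 0
        simp only [sub_zero, sq] at this
        have := (mul_le_mul_left_of_neg ht).1 this
        simp only [id]; linarith
    refine ⟨Fin.cons t (ξ t), funext fun i => ?_⟩
    induction i using Fin.cases with
    | zero => exact ht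
    | succ i => exact hξ' t i

/-- A continuous strongly monotone map of Euclidean space is a homeomorphism: it is onto, and it
expands distances. -/
theorem exists_homeomorph_of_strongly_monotone {d : ℕ}
    {G : EuclideanSpace ℝ (Fin d) → EuclideanSpace ℝ (Fin d)} (hG : Continuous G)
    (hmono : ∀ x y, ‖x - y‖ ^ 2 ≤ inner ℝ (x - y) (G x - G y)) :
    ∃ e : EuclideanSpace ℝ (Fin d) ≃ₜ EuclideanSpace ℝ (Fin d), ⇑e = G := by
  have hexp : AntilipschitzWith 1 G := AntilipschitzWith.of_le_mul_dist fun x y => by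
    have h1 := (hmono x y).trans (real_inner_le_norm _ _)
    rw [NNReal.coe_one, one_mul, dist_eq_norm, dist_eq_norm]
    rcases (norm_nonneg (x - y)).eq_or_lt with h0 | h0
    · rw [← h0]; exact norm_nonneg _
    · rw [sq] at h1; exact le_of_mul_le_mul_left h1 h0
  have hsurj : Function.Surjective G := by
    intro y
    obtain ⟨x, hx⟩ := surjective_of_strongly_monotone_pi d
      (fun x => (G (WithLp.toLp 2 x)).ofLp) (by fun_prop) (fun x x' => by
        have := hmono (WithLp.toLp 2 x) (WithLp.toLp 2 x')
        rw [EuclideanSpace.real_norm_sq_eq, PiLp.inner_apply] at this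
        simpa [mul_comm] using this) y.ofLp
    exact ⟨WithLp.toLp 2 x, by ext i; exact congrFun hx i⟩
  refine ⟨{ toEquiv := Equiv.ofBijective G ⟨hexp.injective, hsurj⟩
            continuous_toFun := hG
            continuous_invFun := ?_ }, rfl⟩
  exact (hexp.to_rightInverse (Equiv.ofBijective G ⟨hexp.injective, hsurj⟩).right_inv).continuous

/-! ### Energy estimates for one step of the scheme -/

/-- The drift part of one step of the theta method. The term `(1 - 2θ) h² ‖e‖²` that appears on
expanding the squares has the good sign because `1 / 2 ≤ θ`. -/
theorem norm_sq_explicit_le {E : Type*} [NormedAddCommGroup E] [InnerProductSpace ℝ E] {θ h : ℝ}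
    (hθ : 1 / 2 ≤ θ) (u e : E) :
    ‖u + ((1 - θ) * h) • e‖ ^ 2 ≤ ‖u - (θ * h) • e‖ ^ 2 + 2 * h * inner ℝ u e := by
  rw [norm_add_sq_real, norm_sub_sq_real, inner_smul_right, inner_smul_right, norm_smul, norm_smul,
    mul_pow, mul_pow, Real.norm_eq_abs, Real.norm_eq_abs, sq_abs, sq_abs]
  nlinarith [mul_nonneg (sub_nonneg.2 hθ) (mul_nonneg (sq_nonneg h) (sq_nonneg ‖e‖))]

/-- The second moment of `u + Z v` for a centred Gaussian `Z`. -/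
theorem lintegral_norm_sq_add_smul_gaussianReal {E : Type*} [NormedAddCommGroup E]
    [InnerProductSpace ℝ E] (h : ℝ≥0) (u v : E) :
    ∫⁻ z, ENNReal.ofReal (‖u + z • v‖ ^ 2) ∂(gaussianReal 0 h) =
      ENNReal.ofReal (‖u‖ ^ 2 + h * ‖v‖ ^ 2) := by
  have hL : MemLp (fun z : ℝ => z) 2 (gaussianReal 0 h) := memLp_id_gaussianReal 2
  have h1 : Integrable (fun z : ℝ => z) (gaussianReal 0 h) := hL.integrable (by norm_num)
  have h2 : Integrable (fun z : ℝ => z ^ 2) (gaussianReal 0 h) := hL.integrable_sq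
  have hm1 : ∫ z, z ∂(gaussianReal 0 h) = 0 := integral_id_gaussianReal
  have hm2 : ∫ z, z ^ 2 ∂(gaussianReal 0 h) = h := by
    have := variance_eq_sub hL
    rw [hm1] at this
    simpa [variance_fun_id_gaussianReal] using this.symm
  have hexp : (fun z : ℝ => ‖u + z • v‖ ^ 2) =
      fun z => ‖u‖ ^ 2 + (2 * inner ℝ u v) * z + ‖v‖ ^ 2 * z ^ 2 := by
    funext z
    rw [norm_add_sq_real, inner_smul_right, norm_smul, mul_pow, Real.norm_eq_abs, sq_abs]
    ring
  have hi1 : Integrable (fun z : ℝ => ‖u‖ ^ 2 + (2 * inner ℝ u v) * z) (gaussianReal 0 h) :=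
    (integrable_const _).add (h1.const_mul _)
  rw [← ofReal_integral_eq_lintegral_ofReal]
  · rw [hexp, integral_add hi1 (h2.const_mul _), integral_add (integrable_const _) (h1.const_mul _),
      integral_const_mul, integral_const_mul, hm1, hm2]
    simp [mul_comm]
  · rw [hexp]; exact hi1.add (h2.const_mul _)
  · exact ae_of_all _ fun _ => by positivity

/-- One-step energy balance. For `u = x`, `e = f x`, `v = g x` it bounds the growth of a trajectory,
and for differences of such quantities it makes two coupled trajectories approach each other. -/
theorem lintegral_norm_sq_step_add_le {E : Type*} [NormedAddCommGroup E]
    [InnerProductSpace ℝ E] {θ : ℝ} (hθ : 1 / 2 ≤ θ) (h : ℝ≥0) {u e v : E} {m s p q : ℝ}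
    (hm : 2 * m + s ≤ 0) (hc : 0 ≤ 2 * p + q)
    (he : inner ℝ u e ≤ m * ‖u‖ ^ 2 + p) (hv : ‖v‖ ^ 2 ≤ s * ‖u‖ ^ 2 + q) :
    (∫⁻ z, ENNReal.ofReal (‖u + ((1 - θ) * h) • e + z • v‖ ^ 2) ∂(gaussianReal 0 h))
        + ENNReal.ofReal (h * (-(2 * m + s))) * ENNReal.ofReal (‖u‖ ^ 2) ≤
      ENNReal.ofReal (‖u - (θ * h) • e‖ ^ 2) + ENNReal.ofReal (h * (2 * p + q)) := by
  have hh : (0 : ℝ) ≤ h := h.2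
  have hk : 0 ≤ h * (-(2 * m + s)) := mul_nonneg hh (by linarith)
  rw [lintegral_norm_sq_add_smul_gaussianReal, ← ENNReal.ofReal_mul hk,
    ← ENNReal.ofReal_add (by positivity) (by positivity),
    ← ENNReal.ofReal_add (by positivity) (by positivity)]
  refine ENNReal.ofReal_le_ofReal ?_
  have h1 := norm_sq_explicit_le (h := h) hθ u e
  nlinarith [mul_le_mul_of_nonneg_left he hh, mul_le_mul_of_nonneg_left hv hh]

/-! ### Random iterations -/

/-- The random iteration `s, T s (z 0), T (T s (z 0)) (z 1), …` started at `s` and driven by the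
noise sequence `z`. -/
def randIter {S N : Type*} (T : S → N → S) (z : ℕ → N) (s : S) : ℕ → S
  | 0 => s
  | k + 1 => T (randIter T z s k) (z k)

section RandIter

variable {S N Ω : Type*} {T : S → N → S}

@[simp] theorem randIter_zero (z : ℕ → N) (s : S) : randIter T z s 0 = s := rfl

theorem randIter_succ (z : ℕ → N) (s : S) (k : ℕ) :
    randIter T z s (k + 1) = T (randIter T z s k) (z k) := rfl

theorem randIter_congr {z z' : ℕ → N} (s : S) {k : ℕ} (h : ∀ i < k, z i = z' i) :
    randIter T z s k = randIter T z' s k := by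
  induction k with
  | zero => rfl
  | succ k ih =>
    rw [randIter_succ, randIter_succ, ih fun i hi => h i (hi.trans k.lt_succ_self),
      h k k.lt_succ_self]

/-- Running two copies of a random iteration on the same noise is again a random iteration. -/
theorem randIter_prod (z : ℕ → N) (s t : S) (k : ℕ) :
    randIter (fun (p : S × S) n => (T p.1 n, T p.2 n)) z (s, t) k =
      (randIter T z s k, randIter T z t k) := by
  induction k with
  | zero => rfl
  | succ k ih => rw [randIter_succ, ih]; rfl

variable [MeasurableSpace S] [MeasurableSpace N] [MeasurableSpace Ω] {P : Measure Ω}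
  {γ : Measure N} {Z : ℕ → Ω → N}

theorem measurable_randIter_uncurry (hT : Measurable (Function.uncurry T))
    (hZ : ∀ k, Measurable (Z k)) (k : ℕ) :
    Measurable fun p : S × Ω => randIter T (fun i => Z i p.2) p.1 k := by
  induction k with
  | zero => exact measurable_fst
  | succ k ih => exact hT.comp (ih.prodMk ((hZ k).comp measurable_snd))

theorem measurable_randIter (hT : Measurable (Function.uncurry T))
    (hZ : ∀ k, Measurable (Z k)) (s : S) (k : ℕ) :
    Measurable fun ω => randIter T (fun i => Z i ω) s k :=
  (measurable_randIter_uncurry hT hZ k).comp (measurable_const.prodMk measurable_id)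

/-- The state at time `k` is a function of the noise before time `k`, hence independent of the
noise at time `k`. -/
theorem indepFun_randIter [IsProbabilityMeasure P] (hT : Measurable (Function.uncurry T))
    (hZ : ∀ k, Measurable (Z k)) (hi : iIndepFun Z P) (s : S) (k : ℕ) :
    IndepFun (fun ω => randIter T (fun i => Z i ω) s k) (Z k) P := by
  classical
  obtain ⟨ω₀⟩ := P.nonempty_of_neZero
  -- the values of the noise from time `k` on do not matter
  let Y : ℕ → (Finset.range k → N) → N := fun i y =>
    if hik : i ∈ Finset.range k then y ⟨i, hik⟩ else Z 0 ω₀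
  have hY : ∀ i, Measurable (Y i) := by
    intro i
    by_cases hik : i ∈ Finset.range k
    · simp only [Y, hik, dite_true]; exact measurable_pi_apply _
    · simp only [Y, hik, dite_false]; exact measurable_const
  have key := (hi.indepFun_finset (Finset.range k) {k} (by simp) hZ).comp
    (measurable_randIter hT hY s k)
    (measurable_pi_apply (⟨k, Finset.mem_singleton_self k⟩ : ({k} : Finset ℕ)))
  have hX : (fun ω => randIter T (fun i => Z i ω) s k) =
      (fun y => randIter T (fun i => Y i y) s k) ∘ fun ω (i : Finset.range k) => Z i ω := by
    funext ω
    exact randIter_congr s fun i hik => by simp [Y, hik]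
  rw [hX]
  exact key

/-- The Markov property of a random iteration with independent identically distributed noise. -/
theorem map_randIter_succ [IsProbabilityMeasure P] (hT : Measurable (Function.uncurry T))
    (hZ : ∀ k, Measurable (Z k)) (hi : iIndepFun Z P) (hγ : ∀ k, P.map (Z k) = γ)
    (s : S) (k : ℕ) :
    P.map (fun ω => randIter T (fun i => Z i ω) s (k + 1)) =
      ((P.map fun ω => randIter T (fun i => Z i ω) s k).prod γ).map (Function.uncurry T) := by
  have hX := measurable_randIter hT hZ s k
  rw [← hγ k, ← (indepFun_iff_map_prod_eq_prod_map_map hX.aemeasurable (hZ k).aemeasurable).1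
    (indepFun_randIter hT hZ hi s k), Measure.map_map hT (hX.prodMk (hZ k))]
  rfl

theorem lintegral_randIter_succ [IsProbabilityMeasure P] (hT : Measurable (Function.uncurry T))
    (hZ : ∀ k, Measurable (Z k)) (hi : iIndepFun Z P) (hγ : ∀ k, P.map (Z k) = γ)
    {W : S → ENNReal} (hW : Measurable W) (s : S) (k : ℕ) :
    ∫⁻ ω, W (randIter T (fun i => Z i ω) s (k + 1)) ∂P =
      ∫⁻ ω, ∫⁻ z, W (T (randIter T (fun i => Z i ω) s k) z) ∂γ ∂P := by
  have hX := measurable_randIter hT hZ s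
  have hWT : Measurable fun p : S × N => W (T p.1 p.2) := hW.comp hT
  have hfin : IsFiniteMeasure γ := hγ k ▸ inferInstance
  rw [← lintegral_map hW (hX (k + 1)), map_randIter_succ hT hZ hi hγ s k, lintegral_map hW hT,
    ← lintegral_map hWT.lintegral_prod_right' (hX k), ← lintegral_prod _ hWT.aemeasurable]
  rfl

/-- Summing a one-step drift inequality along the trajectory. -/
theorem lintegral_randIter_add_sum_le [IsProbabilityMeasure P]
    (hT : Measurable (Function.uncurry T))
    (hZ : ∀ k, Measurable (Z k)) (hi : iIndepFun Z P) (hγ : ∀ k, P.map (Z k) = γ)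
    {V U : S → ENNReal} (hV : Measurable V) (hU : Measurable U) {c : ENNReal}
    (hdrift : ∀ s, (∫⁻ z, V (T s z) ∂γ) + U s ≤ V s + c) (s : S) (n : ℕ) :
    (∫⁻ ω, V (randIter T (fun i => Z i ω) s n) ∂P)
      + ∑ k ∈ Finset.range n, ∫⁻ ω, U (randIter T (fun i => Z i ω) s k) ∂P ≤ V s + n * c := by
  induction n with
  | zero => simp
  | succ n ih =>
    have hX := measurable_randIter hT hZ s n
    have hstep : (∫⁻ ω, V (randIter T (fun i => Z i ω) s (n + 1)) ∂P)
        + ∫⁻ ω, U (randIter T (fun i => Z i ω) s n) ∂P ≤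
        (∫⁻ ω, V (randIter T (fun i => Z i ω) s n) ∂P) + c := by
      have hUX : Measurable fun ω => U (randIter T (fun i => Z i ω) s n) := hU.comp hX
      rw [lintegral_randIter_succ hT hZ hi hγ hV, ← lintegral_add_right _ hUX]
      refine (lintegral_mono fun ω => hdrift _).trans_eq ?_
      rw [lintegral_add_right _ measurable_const, lintegral_const, measure_univ, mul_one]
    rw [Finset.sum_range_succ, add_comm (∑ k ∈ _, _), ← add_assoc]
    calc _ ≤ (∫⁻ ω, V (randIter T (fun i => Z i ω) s n) ∂P) + c
          + ∑ k ∈ Finset.range n, ∫⁻ ω, U (randIter T (fun i => Z i ω) s k) ∂P := by gcongr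
      _ = (∫⁻ ω, V (randIter T (fun i => Z i ω) s n) ∂P)
          + ∑ k ∈ Finset.range n, ∫⁻ ω, U (randIter T (fun i => Z i ω) s k) ∂P + c := by ring
      _ ≤ V s + n * c + c := by gcongr
      _ = _ := by push_cast; ring

/-- If one step decreases the Lyapunov function `V` by `U` on average, then `U` is summable along
the trajectory, so that its expectation vanishes in the limit. -/
theorem tendsto_lintegral_randIter_zero [IsProbabilityMeasure P]
    (hT : Measurable (Function.uncurry T))
    (hZ : ∀ k, Measurable (Z k)) (hi : iIndepFun Z P) (hγ : ∀ k, P.map (Z k) = γ)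
    {V U : S → ENNReal} (hV : Measurable V) (hU : Measurable U)
    (hdrift : ∀ s, (∫⁻ z, V (T s z) ∂γ) + U s ≤ V s) {s : S} (hs : V s ≠ ⊤) :
    Tendsto (fun k => ∫⁻ ω, U (randIter T (fun i => Z i ω) s k) ∂P) atTop (𝓝 0) := by
  refine ENNReal.tendsto_atTop_zero_of_tsum_ne_top (ne_top_of_le_ne_top hs ?_)
  refine ENNReal.tsum_le_of_sum_range_le fun n => ?_
  have := lintegral_randIter_add_sum_le hT hZ hi hγ hV hU (c := 0) (by simpa using hdrift) s n
  simp only [mul_zero, add_zero] at this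
  exact le_add_self.trans this

/-- If `π` is invariant under one step, then the iteration started from `π` has law `π` at all
times. -/
theorem map_randIter_of_invariant [IsProbabilityMeasure P] {π : Measure S}
    [IsProbabilityMeasure π] [IsProbabilityMeasure γ]
    (hT : Measurable (Function.uncurry T))
    (hZ : ∀ k, Measurable (Z k)) (hi : iIndepFun Z P) (hγ : ∀ k, P.map (Z k) = γ)
    (hπ : (π.prod γ).map (Function.uncurry T) = π) (k : ℕ) :
    (π.prod P).map (fun p => randIter T (fun i => Z i p.2) p.1 k) = π := by
  induction k with
  | zero => simp
  | succ k ih =>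
    refine Measure.ext_of_lintegral _ fun W hW => ?_
    have hX := measurable_randIter_uncurry hT hZ (T := T)
    have hWT : Measurable fun p : S × N => W (T p.1 p.2) := hW.comp hT
    have hWX : Measurable fun p : S × Ω => W (randIter T (fun i => Z i p.2) p.1 (k + 1)) :=
      hW.comp (hX _)
    rw [lintegral_map hW (hX _), lintegral_prod _ hWX.aemeasurable]
    simp_rw [lintegral_randIter_succ hT hZ hi hγ hW]
    have hQ : Measurable fun s => ∫⁻ z, W (T s z) ∂γ := hWT.lintegral_prod_right'
    rw [← lintegral_prod (fun p : S × Ω => ∫⁻ z, W (T (randIter T (fun i => Z i p.2) p.1 k) z) ∂γ)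
        (hQ.comp (hX k)).aemeasurable,
      ← lintegral_map hQ (hX k), ih, ← lintegral_prod _ hWT.aemeasurable]
    conv_rhs => rw [← hπ, lintegral_map hW hT]
    rfl

end RandIter

/-! ### Existence of an invariant measure -/

section KrylovBogoliubov

variable {E N : Type*} [NormedAddCommGroup E] [NormedSpace ℝ E] [FiniteDimensional ℝ E]
  [MeasurableSpace E] [BorelSpace E]

/-- A set of measures with bounded second moments is tight. -/
theorem isTightMeasureSet_of_lintegral_norm_sq_le {S : Set (Measure E)} {C : ENNReal}
    (hC : C ≠ ⊤) (h : ∀ μ ∈ S, ∫⁻ x, ENNReal.ofReal (‖x‖ ^ 2) ∂μ ≤ C) : IsTightMeasureSet S := by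
  have : ProperSpace E := FiniteDimensional.proper ℝ E
  refine isTightMeasureSet_of_tendsto_measure_norm_gt ?_
  have hlim : Tendsto (fun r : ℝ => C / ENNReal.ofReal (r ^ 2)) atTop (𝓝 0) := by
    have h1 : Tendsto (fun r : ℝ => ENNReal.ofReal (r ^ 2)) atTop (𝓝 ⊤) :=
      ENNReal.tendsto_ofReal_atTop.comp (tendsto_pow_atTop two_ne_zero)
    simpa using ENNReal.Tendsto.const_div h1 (Or.inr hC)
  refine tendsto_of_tendsto_of_tendsto_of_le_of_le' tendsto_const_nhds hlim
    (Eventually.of_forall fun _ => zero_le) ?_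
  filter_upwards [eventually_gt_atTop 0] with r hr
  refine iSup₂_le fun μ hμ => ?_
  have hm : Measurable fun x : E => ENNReal.ofReal (‖x‖ ^ 2) := by fun_prop
  refine (measure_mono fun x (hx : r < ‖x‖) => ?_).trans
    ((meas_ge_le_lintegral_div hm.aemeasurable (ε := ENNReal.ofReal (r ^ 2))
      (by simpa using hr.ne') ENNReal.ofReal_ne_top).trans (ENNReal.div_le_div_right (h μ hμ) _))
  exact ENNReal.ofReal_le_ofReal (by gcongr)

variable [TopologicalSpace N] [SecondCountableTopology N] [MeasurableSpace N] [BorelSpace N]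

/-- The **Krylov–Bogoliubov** argument: if the laws `L k` of a Feller chain have second moments that
are bounded on time average, then the time averages of the laws are tight, and any limit point is
an invariant measure. -/
theorem exists_invariant_measure_of_second_moment {T : E → N → E}
    (hT : Continuous (Function.uncurry T)) {γ : Measure N} [IsProbabilityMeasure γ]
    {L : ℕ → Measure E} [∀ k, IsProbabilityMeasure (L k)]
    (hL : ∀ k, L (k + 1) = ((L k).prod γ).map (Function.uncurry T)) {C : ENNReal} (hC : C ≠ ⊤)
    (hb : ∀ n : ℕ, ∑ k ∈ Finset.range n, ∫⁻ x, ENNReal.ofReal (‖x‖ ^ 2) ∂(L k) ≤ n * C) :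
    ∃ π : Measure E, IsProbabilityMeasure π ∧ (π.prod γ).map (Function.uncurry T) = π := by
  have : ProperSpace E := FiniteDimensional.proper ℝ E
  have hTm : Measurable (Function.uncurry T) := hT.measurable
  -- the time averages, over `n + 1` steps so that no average is empty
  let m : ℕ → Measure E := fun n => ((n + 1 : ℕ) : ENNReal)⁻¹ • ∑ k ∈ Finset.range (n + 1), L k
  have hn0 : ∀ n : ℕ, ((n + 1 : ℕ) : ENNReal) ≠ 0 := fun n => by simp
  have hnt : ∀ n : ℕ, ((n + 1 : ℕ) : ENNReal) ≠ ⊤ := fun n => ENNReal.natCast_ne_top _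
  have hm : ∀ n, IsProbabilityMeasure (m n) := fun n => ⟨by
    simp only [m, Measure.smul_apply, Measure.finsetSum_apply, measure_univ, Finset.sum_const,
      Finset.card_range, smul_eq_mul, nsmul_eq_mul, mul_one]
    exact ENNReal.inv_mul_cancel (hn0 n) (hnt n)⟩
  have hmint : ∀ n (F : BoundedContinuousFunction E ℝ),
      ∫ x, F x ∂(m n) = ((n + 1 : ℕ) : ℝ)⁻¹ * ∑ k ∈ Finset.range (n + 1), ∫ x, F x ∂(L k) := by
    intro n F
    rw [integral_smul_measure, integral_finsetSum_measure fun k _ => F.integrable _,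
      ENNReal.toReal_inv, ENNReal.toReal_natCast, smul_eq_mul]
  let M : ℕ → ProbabilityMeasure E := fun n => ⟨m n, hm n⟩
  have htight : IsCompact (closure (Set.range M)) := by
    refine isCompact_closure_of_isTightMeasureSet
      (isTightMeasureSet_of_lintegral_norm_sq_le hC ?_)
    rintro _ ⟨_, ⟨n, rfl⟩, rfl⟩
    change ∫⁻ x, ENNReal.ofReal (‖x‖ ^ 2) ∂(m n) ≤ C
    rw [lintegral_smul_measure, lintegral_finsetSum_measure, smul_eq_mul]
    calc _ ≤ ((n + 1 : ℕ) : ENNReal)⁻¹ * (((n + 1 : ℕ) : ENNReal) * C) := by gcongr; exact hb _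
      _ = C := by rw [← mul_assoc, ENNReal.inv_mul_cancel (hn0 n) (hnt n), one_mul]
  obtain ⟨π, -, hπ⟩ := htight.ultrafilter_le_nhds ((hyperfilter ℕ).map M)
    (le_principal_iff.2 (mem_map.2 (univ_mem' fun n => subset_closure ⟨n, rfl⟩)))
  have hlim : Tendsto M (hyperfilter ℕ : Filter ℕ) (𝓝 π) := hπ
  refine ⟨π, inferInstance, ?_⟩
  have hpm : ∀ ρ : Measure E, IsProbabilityMeasure ρ →
      IsProbabilityMeasure ((ρ.prod γ).map (Function.uncurry T)) := fun ρ _ =>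
    Measure.isProbabilityMeasure_map hTm.aemeasurable
  have := hpm π inferInstance
  refine ext_of_forall_integral_eq_of_IsFiniteMeasure fun F => ?_
  -- the transition operator maps `F` to a bounded continuous function
  let Q : BoundedContinuousFunction E ℝ := BoundedContinuousFunction.ofNormedAddCommGroup
    (fun x => ∫ z, F (T x z) ∂γ)
    (continuous_of_dominated (bound := fun _ => ‖F‖)
      (fun x => (F.continuous.comp (hT.comp (by fun_prop :
        Continuous fun z : N => (x, z)))).aestronglyMeasurable)
      (fun x => ae_of_all _ fun z => F.norm_coe_le_norm _) (integrable_const _)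
      (ae_of_all _ fun z => F.continuous.comp (hT.comp (by fun_prop :
        Continuous fun x : E => (x, z))))) ‖F‖
    (fun x => by
      simpa using norm_integral_le_of_norm_le_const (μ := γ)
        (ae_of_all _ fun z => F.norm_coe_le_norm (T x z)))
  have hQ : ∀ ρ : Measure E, IsProbabilityMeasure ρ →
      ∫ x, F x ∂((ρ.prod γ).map (Function.uncurry T)) = ∫ x, Q x ∂ρ := by
    intro ρ hρ
    have := hpm ρ hρ
    rw [integral_map hTm.aemeasurable F.continuous.aestronglyMeasurable, integral_prod]
    · rfl
    · exact (integrable_map_measure F.continuous.aestronglyMeasurable hTm.aemeasurable).1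
        (F.integrable _)
  have hint : ∀ G : BoundedContinuousFunction E ℝ,
      Tendsto (fun n => ∫ x, G x ∂(m n)) (hyperfilter ℕ : Filter ℕ) (𝓝 (∫ x, G x ∂π)) := fun G =>
    ProbabilityMeasure.tendsto_iff_forall_integral_tendsto.1 hlim G
  -- the defect of invariance of the time average telescopes
  have hdefect : Tendsto (fun n => ∫ x, Q x ∂(m n) - ∫ x, F x ∂(m n)) atTop (𝓝 0) := by
    have h0 : Tendsto (fun n : ℕ => ((n + 1 : ℕ) : ℝ)⁻¹ * (‖F‖ + ‖F‖)) atTop (𝓝 0) := by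
      have := (tendsto_inv_atTop_zero.comp (tendsto_natCast_atTop_atTop (R := ℝ))).comp
        (tendsto_add_atTop_nat 1)
      simpa using this.mul_const (‖F‖ + ‖F‖)
    refine squeeze_zero_norm (fun n => ?_) h0
    have hb : ∀ k, ‖∫ x, F x ∂(L k)‖ ≤ ‖F‖ := fun k => by
      simpa using norm_integral_le_of_norm_le_const (μ := L k)
        (ae_of_all _ fun x => F.norm_coe_le_norm x)
    rw [hmint, hmint, ← mul_sub, ← Finset.sum_sub_distrib,
      Finset.sum_congr rfl fun k _ => by rw [← hQ (L k) inferInstance, ← hL k],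
      Finset.sum_range_sub fun k => ∫ x, F x ∂(L k), norm_mul, norm_inv, Real.norm_natCast]
    gcongr
    exact (norm_sub_le _ _).trans (add_le_add (hb _) (hb _))
  rw [hQ π inferInstance]
  exact sub_eq_zero.1 (tendsto_nhds_unique ((hint Q).sub (hint F))
    (hdefect.mono_left Nat.hyperfilter_le_atTop))

end KrylovBogoliubov

/-! ### The bounded Lipschitz distance -/

section DistL

variable {d : ℕ}

theorem continuous_of_mem_testL {F : EuclideanSpace ℝ (Fin d) → ℝ} (hF : F ∈ testL d) :
    Continuous F :=
  (LipschitzWith.of_dist_le_mul (K := 1) fun x y => by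
    simpa [Real.dist_eq, dist_eq_norm] using hF.1 x y).continuous

theorem distL_nonneg (μ ν : Measure (EuclideanSpace ℝ (Fin d))) : 0 ≤ distL μ ν :=
  Real.iSup_nonneg fun _ => abs_nonneg _

theorem abs_integral_sub_le_distL {F : EuclideanSpace ℝ (Fin d) → ℝ} (hF : F ∈ testL d)
    (μ ν : Measure (EuclideanSpace ℝ (Fin d))) [IsProbabilityMeasure μ] [IsProbabilityMeasure ν] :
    |∫ x, F x ∂μ - ∫ x, F x ∂ν| ≤ distL μ ν := by
  have hle : ∀ (ρ : Measure (EuclideanSpace ℝ (Fin d))) [IsProbabilityMeasure ρ] (F : testL d),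
      |∫ x, F.1 x ∂ρ| ≤ 1 := fun ρ _ F => by
    simpa using norm_integral_le_of_norm_le_const (μ := ρ) (f := F.1) (C := 1)
      (ae_of_all _ F.2.2)
  refine le_ciSup (f := fun F : testL d => |∫ x, F.1 x ∂μ - ∫ x, F.1 x ∂ν|) ⟨1 + 1, ?_⟩ ⟨F, hF⟩
  rintro _ ⟨F, rfl⟩
  exact (abs_sub _ _).trans (add_le_add (hle μ F) (hle ν F))

/-- Limits for `distL` are unique, since bounded Lipschitz functions separate measures. -/
theorem eq_of_tendsto_distL {μ : ℕ → Measure (EuclideanSpace ℝ (Fin d))}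
    [∀ k, IsProbabilityMeasure (μ k)] {π π' : ProbabilityMeasure (EuclideanSpace ℝ (Fin d))}
    (h : Tendsto (fun k => distL (μ k) (π : Measure (EuclideanSpace ℝ (Fin d)))) atTop (𝓝 0))
    (h' : Tendsto (fun k => distL (μ k) (π' : Measure (EuclideanSpace ℝ (Fin d)))) atTop (𝓝 0)) :
    π = π' := by
  have htest : ∀ F ∈ testL d, ∫ x, F x ∂(π : Measure (EuclideanSpace ℝ (Fin d))) =
      ∫ x, F x ∂(π' : Measure (EuclideanSpace ℝ (Fin d))) := by
    intro F hF
    refine tendsto_nhds_unique (f := fun k => ∫ x, F x ∂(μ k)) (l := atTop)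
      (tendsto_iff_dist_tendsto_zero.2 ?_) (tendsto_iff_dist_tendsto_zero.2 ?_)
    · exact squeeze_zero (fun _ => dist_nonneg) (fun k => abs_integral_sub_le_distL hF _ _) h
    · exact squeeze_zero (fun _ => dist_nonneg) (fun k => abs_integral_sub_le_distL hF _ _) h'
  have hconst : Tendsto (fun _ : ℕ => π) atTop (𝓝 π') := by
    refine tendsto_iff_forall_lipschitz_integral_tendsto.2 ?_
    rintro f ⟨C, hC⟩ ⟨L, hL⟩
    -- rescale `f` to a test function
    set K : ℝ := 1 + |C| + L
    have hK : 0 < K := by positivity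
    have hF : (fun x => K⁻¹ * (f x - f 0)) ∈ testL d := by
      refine ⟨fun x y => ?_, fun x => ?_⟩
      · rw [← mul_sub, sub_sub_sub_cancel_right, abs_mul, abs_of_pos (inv_pos.2 hK),
          inv_mul_le_iff₀ hK]
        have h1 := hL.dist_le_mul x y
        rw [Real.dist_eq, dist_eq_norm] at h1
        refine h1.trans (mul_le_mul_of_nonneg_right ?_ (norm_nonneg _))
        linarith [abs_nonneg C]
      · rw [abs_mul, abs_of_pos (inv_pos.2 hK), inv_mul_le_iff₀ hK, mul_one]
        have h1 := hC x 0
        rw [Real.dist_eq] at h1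
        linarith [le_abs_self C, L.coe_nonneg]
    have hfi : ∀ ρ : ProbabilityMeasure (EuclideanSpace ℝ (Fin d)),
        ∫ x, f x ∂(ρ : Measure (EuclideanSpace ℝ (Fin d))) =
          K * ∫ x, K⁻¹ * (f x - f 0) ∂(ρ : Measure (EuclideanSpace ℝ (Fin d))) + f 0 := by
      intro ρ
      rw [← integral_const_mul]
      simp_rw [mul_inv_cancel_left₀ hK.ne']
      have hi : Integrable (fun x => f x - f 0) (ρ : Measure (EuclideanSpace ℝ (Fin d))) :=
        Integrable.of_bound (hL.continuous.sub continuous_const).aestronglyMeasurable C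
          (ae_of_all _ fun x => hC x 0)
      simpa using integral_add hi (integrable_const (f 0))
    rw [hfi π, hfi π', htest _ hF]
    exact tendsto_const_nhds
  exact tendsto_nhds_unique tendsto_const_nhds hconst

/-- The distance of two laws is controlled by any coupling of them. The cap at `4 = 2 ^ 2` comes from
the bound `1` on test functions; it is what makes dominated convergence applicable below. -/
theorem distL_map_le {Ω : Type*} [MeasurableSpace Ω] {ρ : Measure Ω} [IsProbabilityMeasure ρ]
    {U V : Ω → EuclideanSpace ℝ (Fin d)} (hU : Measurable U) (hV : Measurable V) :
    distL (ρ.map U) (ρ.map V) ≤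
      √(∫⁻ ω, min 4 (ENNReal.ofReal (‖U ω - V ω‖ ^ 2)) ∂ρ).toReal := by
  refine Real.iSup_le (fun F => Real.abs_le_sqrt ?_) (Real.sqrt_nonneg _)
  have hFc := continuous_of_mem_testL F.2
  have hb : ∀ ω, |F.1 (U ω) - F.1 (V ω)| ≤ 2 := fun ω =>
    (abs_sub _ _).trans (by linarith [F.2.2 (U ω), F.2.2 (V ω)])
  have hms : AEStronglyMeasurable (fun ω => F.1 (U ω) - F.1 (V ω)) ρ :=
    ((hFc.measurable.comp hU).sub (hFc.measurable.comp hV)).aestronglyMeasurable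
  have hL2 : MemLp (fun ω => F.1 (U ω) - F.1 (V ω)) 2 ρ := MemLp.of_bound hms 2 (ae_of_all _ hb)
  have hiU : Integrable (fun ω => F.1 (U ω)) ρ :=
    Integrable.of_bound (hFc.measurable.comp hU).aestronglyMeasurable 1
      (ae_of_all _ fun ω => by simpa using F.2.2 (U ω))
  have hiV : Integrable (fun ω => F.1 (V ω)) ρ :=
    Integrable.of_bound (hFc.measurable.comp hV).aestronglyMeasurable 1
      (ae_of_all _ fun ω => by simpa using F.2.2 (V ω))
  rw [integral_map hU.aemeasurable hFc.aestronglyMeasurable,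
    integral_map hV.aemeasurable hFc.aestronglyMeasurable, ← integral_sub hiU hiV]
  -- the squared mean is at most the mean square, as the variance is nonnegative
  have hvar := variance_nonneg (fun ω => F.1 (U ω) - F.1 (V ω)) ρ
  rw [variance_eq_sub hL2, sub_nonneg] at hvar
  refine hvar.trans ?_
  simp only [Pi.pow_apply]
  rw [integral_eq_lintegral_of_nonneg_ae (ae_of_all _ fun _ => sq_nonneg _) (hms.pow 2)]
  refine ENNReal.toReal_mono (ne_top_of_le_ne_top (b := 4) (by simp) ?_) (lintegral_mono fun ω => ?_)
  · exact (lintegral_mono fun ω => min_le_left _ _).trans (by simp)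
  · refine le_min ?_ (ENNReal.ofReal_le_ofReal ?_)
    · rw [show (4 : ENNReal) = ENNReal.ofReal (2 ^ 2) by norm_num, ← sq_abs]
      exact ENNReal.ofReal_le_ofReal (by gcongr; exact hb ω)
    · rw [← sq_abs]; gcongr; exact F.2.1 _ _

end DistL

/-! ### Convergence to the invariant measure -/

/-- A random iteration whose coupled trajectories approach each other in mean square forgets its
initial value, and hence converges to any invariant measure. -/
theorem tendsto_distL_randIter {d : ℕ} {N Ω : Type*} [MeasurableSpace N] [MeasurableSpace Ω]
    {P : Measure Ω} [IsProbabilityMeasure P] {γ : Measure N} [IsProbabilityMeasure γ]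
    {Z : ℕ → Ω → N} {T : EuclideanSpace ℝ (Fin d) → N → EuclideanSpace ℝ (Fin d)}
    (hT : Measurable (Function.uncurry T)) (hZ : ∀ k, Measurable (Z k)) (hi : iIndepFun Z P)
    (hγ : ∀ k, P.map (Z k) = γ) {π : Measure (EuclideanSpace ℝ (Fin d))} [IsProbabilityMeasure π]
    (hπ : (π.prod γ).map (Function.uncurry T) = π)
    (hD : ∀ x y, Tendsto (fun k => ∫⁻ ω, ENNReal.ofReal
      (‖randIter T (fun i => Z i ω) x k - randIter T (fun i => Z i ω) y k‖ ^ 2) ∂P) atTop (𝓝 0))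
    (x : EuclideanSpace ℝ (Fin d)) :
    Tendsto (fun k => distL (P.map fun ω => randIter T (fun i => Z i ω) x k) π) atTop (𝓝 0) := by
  have hX := measurable_randIter_uncurry hT hZ (T := T)
  have hx : ∀ k, Measurable fun p : EuclideanSpace ℝ (Fin d) × Ω =>
      randIter T (fun i => Z i p.2) x k := fun k => (measurable_randIter hT hZ x k).comp measurable_snd
  have hm : ∀ k, Measurable fun p : EuclideanSpace ℝ (Fin d) × Ω => min 4 (ENNReal.ofReal
      (‖randIter T (fun i => Z i p.2) x k - randIter T (fun i => Z i p.2) p.1 k‖ ^ 2)) := fun k =>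
    measurable_const.min (((hx k).sub (hX k)).norm.pow_const 2).ennreal_ofReal
  have hlim : Tendsto (fun k => ∫⁻ p, min 4 (ENNReal.ofReal
      (‖randIter T (fun i => Z i p.2) x k - randIter T (fun i => Z i p.2) p.1 k‖ ^ 2))
      ∂(π.prod P)) atTop (𝓝 0) := by
    simp_rw [lintegral_prod _ (hm _).aemeasurable]
    have := tendsto_lintegral_of_dominated_convergence (μ := π)
      (F := fun k y => ∫⁻ ω, min 4 (ENNReal.ofReal
        (‖randIter T (fun i => Z i ω) x k - randIter T (fun i => Z i ω) y k‖ ^ 2)) ∂P)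
      (f := fun _ => 0) (fun _ => 4) (fun k => (hm k).lintegral_prod_right')
      (fun k => ae_of_all _ fun y => (lintegral_mono fun ω => min_le_left _ _).trans (by simp))
      (by simp)
      (ae_of_all _ fun y => tendsto_of_tendsto_of_tendsto_of_le_of_le tendsto_const_nhds (hD x y)
        (fun _ => zero_le) fun k => lintegral_mono fun ω => min_le_right _ _)
    simpa using this
  have hlim' := (Real.continuous_sqrt.tendsto _).comp
    ((ENNReal.tendsto_toReal ENNReal.zero_ne_top).comp hlim)
  simp only [ENNReal.toReal_zero, Real.sqrt_zero] at hlim'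
  refine squeeze_zero (fun _ => distL_nonneg _ _) (fun k => ?_) hlim'
  have h1 : (π.prod P).map (fun p => randIter T (fun i => Z i p.2) x k) =
      P.map fun ω => randIter T (fun i => Z i ω) x k := by
    rw [← Function.comp_def (fun ω => randIter T (fun i => Z i ω) x k) Prod.snd,
      ← Measure.map_map (measurable_randIter hT hZ x k) measurable_snd, Measure.map_snd_prod]
    simp
  have h2 := map_randIter_of_invariant hT hZ hi hγ hπ k
  have h3 := distL_map_le (ρ := π.prod P) (hx k) (hX k)
  rw [h1, h2] at h3
  exact h3

/-- Ergodicity of a Feller random iteration from two Lyapunov inequalities: one for single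
trajectories, which yields an invariant measure, and one for pairs of trajectories driven by the
same noise, which makes them coalesce. -/
theorem exists_tendsto_distL_randIter {d : ℕ} {N Ω : Type*} [TopologicalSpace N]
    [SecondCountableTopology N] [MeasurableSpace N] [BorelSpace N] [MeasurableSpace Ω]
    {P : Measure Ω} [IsProbabilityMeasure P] {γ : Measure N} [IsProbabilityMeasure γ]
    {Z : ℕ → Ω → N} {T : EuclideanSpace ℝ (Fin d) → N → EuclideanSpace ℝ (Fin d)}
    (hT : Continuous (Function.uncurry T)) (hZ : ∀ k, Measurable (Z k)) (hi : iIndepFun Z P)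
    (hγ : ∀ k, P.map (Z k) = γ) {G : EuclideanSpace ℝ (Fin d) → EuclideanSpace ℝ (Fin d)}
    (hG : Continuous G) {κ κ' c : ℝ} (hκ : 0 < κ) (hκ' : 0 < κ')
    (hdrift : ∀ x, (∫⁻ z, ENNReal.ofReal (‖G (T x z)‖ ^ 2) ∂γ)
      + ENNReal.ofReal κ * ENNReal.ofReal (‖x‖ ^ 2) ≤
        ENNReal.ofReal (‖G x‖ ^ 2) + ENNReal.ofReal c)
    (hdrift' : ∀ x y, (∫⁻ z, ENNReal.ofReal (‖G (T x z) - G (T y z)‖ ^ 2) ∂γ)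
      + ENNReal.ofReal κ' * ENNReal.ofReal (‖x - y‖ ^ 2) ≤ ENNReal.ofReal (‖G x - G y‖ ^ 2)) :
    ∃ π : ProbabilityMeasure (EuclideanSpace ℝ (Fin d)), ∀ x,
      Tendsto (fun k => distL (P.map fun ω => randIter T (fun i => Z i ω) x k)
        (π : Measure (EuclideanSpace ℝ (Fin d)))) atTop (𝓝 0) := by
  have hTm : Measurable (Function.uncurry T) := hT.measurable
  have hL : ∀ k, IsProbabilityMeasure (P.map fun ω => randIter T (fun i => Z i ω) 0 k) := fun k =>
    Measure.isProbabilityMeasure_map (measurable_randIter hTm hZ 0 k).aemeasurable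
  have hκ0 : ENNReal.ofReal κ ≠ 0 := by simpa using hκ
  have hκ0' : ENNReal.ofReal κ' ≠ 0 := by simpa using hκ'
  obtain ⟨π, hπp, hπ⟩ := exists_invariant_measure_of_second_moment hT (γ := γ)
    (L := fun k => P.map fun ω => randIter T (fun i => Z i ω) 0 k)
    (fun k => map_randIter_succ hTm hZ hi hγ 0 k)
    (C := (ENNReal.ofReal κ)⁻¹ * (ENNReal.ofReal (‖G 0‖ ^ 2) + ENNReal.ofReal c))
    (ENNReal.mul_ne_top (ENNReal.inv_ne_top.2 hκ0)
      (ENNReal.add_ne_top.2 ⟨ENNReal.ofReal_ne_top, ENNReal.ofReal_ne_top⟩))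
    (fun n => by
      rcases Nat.eq_zero_or_pos n with rfl | hn
      · simp
      have hU : Measurable fun x : EuclideanSpace ℝ (Fin d) => ENNReal.ofReal (‖x‖ ^ 2) := by
        fun_prop
      -- for `n ≥ 1` the initial energy is absorbed into the constant
      have hsum := lintegral_randIter_add_sum_le hTm hZ hi hγ
        (V := fun x => ENNReal.ofReal (‖G x‖ ^ 2))
        (U := fun x => ENNReal.ofReal κ * ENNReal.ofReal (‖x‖ ^ 2)) (by fun_prop) (by fun_prop)
        hdrift 0 n
      have h1 := le_add_self.trans hsum
      have h2 : ∀ k, ∫⁻ ω, ENNReal.ofReal κ *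
          ENNReal.ofReal (‖randIter T (fun i => Z i ω) 0 k‖ ^ 2) ∂P = ENNReal.ofReal κ *
          ∫⁻ x, ENNReal.ofReal (‖x‖ ^ 2) ∂(P.map fun ω => randIter T (fun i => Z i ω) 0 k) :=
        fun k => by
          rw [lintegral_map hU (measurable_randIter hTm hZ 0 k),
            lintegral_const_mul' _ _ ENNReal.ofReal_ne_top]
      simp_rw [h2] at h1
      rw [← Finset.mul_sum] at h1
      rw [mul_left_comm, ← ENNReal.mul_le_iff_le_inv hκ0 ENNReal.ofReal_ne_top, mul_add]
      refine h1.trans (add_le_add_left ?_ _)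
      exact le_mul_of_one_le_left zero_le (by exact_mod_cast hn))
  refine ⟨⟨π, hπp⟩, tendsto_distL_randIter (π := π) hTm hZ hi hγ hπ fun x y => ?_⟩
  -- the two-point motion: both trajectories see the same noise
  let T₂ : EuclideanSpace ℝ (Fin d) × EuclideanSpace ℝ (Fin d) → N →
      EuclideanSpace ℝ (Fin d) × EuclideanSpace ℝ (Fin d) := fun p n => (T p.1 n, T p.2 n)
  have hT₂ : Continuous (Function.uncurry T₂) :=
    (hT.comp (by fun_prop : Continuous
      fun q : (EuclideanSpace ℝ (Fin d) × EuclideanSpace ℝ (Fin d)) × N => (q.1.1, q.2))).prodMk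
    (hT.comp (by fun_prop : Continuous
      fun q : (EuclideanSpace ℝ (Fin d) × EuclideanSpace ℝ (Fin d)) × N => (q.1.2, q.2)))
  have hlim := tendsto_lintegral_randIter_zero (T := T₂) hT₂.measurable hZ hi hγ
    (V := fun p => ENNReal.ofReal (‖G p.1 - G p.2‖ ^ 2))
    (U := fun p => ENNReal.ofReal κ' * ENNReal.ofReal (‖p.1 - p.2‖ ^ 2))
    (by fun_prop) (by fun_prop) (fun p => hdrift' p.1 p.2) (s := (x, y)) ENNReal.ofReal_ne_top
  have hlim' := ENNReal.Tendsto.const_mul (a := (ENNReal.ofReal κ')⁻¹) hlim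
    (Or.inr (ENNReal.inv_ne_top.2 hκ0'))
  rw [mul_zero] at hlim'
  refine hlim'.congr fun k => ?_
  rw [lintegral_const_mul' _ _ ENNReal.ofReal_ne_top, ← mul_assoc,
    ENNReal.inv_mul_cancel hκ0' ENNReal.ofReal_ne_top, one_mul]
  simp_rw [T₂, randIter_prod]

/-! ### The stochastic theta method -/

/-- The increments of a Brownian motion over the grid `h ℕ` are a Gaussian white noise. They are
replaced by measurable versions, since a Brownian motion need only be almost everywhere
measurable. -/
theorem exists_noise_of_isBrownianReal {Ω : Type*} [MeasurableSpace Ω] {P : Measure Ω}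
    {B : ℝ≥0 → Ω → ℝ} (hB : IsBrownianReal B P) (h : ℝ≥0) :
    ∃ Z : ℕ → Ω → ℝ, (∀ k, Measurable (Z k)) ∧ iIndepFun Z P ∧
      (∀ k, P.map (Z k) = gaussianReal 0 h) ∧
      ∀ᵐ ω ∂P, ∀ k : ℕ, B (((k : ℝ≥0) + 1) * h) ω - B ((k : ℝ≥0) * h) ω = Z k ω := by
  have hlaw : ∀ k : ℕ, HasLaw (B (((k : ℝ≥0) + 1) * h) - B ((k : ℝ≥0) * h)) (gaussianReal 0 h) P := by
    intro k
    have := hB.toIsPreBrownianReal.hasLaw_sub (((k : ℝ≥0) + 1) * h) ((k : ℝ≥0) * h)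
    convert this using 2
    ext
    change (h : ℝ) = dist ((((k : ℝ≥0) + 1) * h : ℝ≥0) : ℝ) (((k : ℝ≥0) * h : ℝ≥0) : ℝ)
    rw [Real.dist_eq]
    push_cast
    rw [add_mul, one_mul, add_sub_cancel_left, NNReal.abs_eq]
  have hind : iIndepFun (fun (k : ℕ) => B (((k : ℝ≥0) + 1) * h) - B ((k : ℝ≥0) * h)) P := by
    have := hB.toIsPreBrownianReal.hasIndepIncrements.nat (t := fun k : ℕ => (k : ℝ≥0) * h)
      (fun i j hij => by dsimp only; gcongr)
    simp only [Nat.cast_add, Nat.cast_one] at this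
    exact this
  refine ⟨fun k => (hlaw k).aemeasurable.mk _, fun k => (hlaw k).aemeasurable.measurable_mk,
    hind.congr fun k => (hlaw k).aemeasurable.ae_eq_mk, fun k => ?_,
    ae_all_iff.2 fun k => (hlaw k).aemeasurable.ae_eq_mk⟩
  rw [← Measure.map_congr (hlaw k).aemeasurable.ae_eq_mk, (hlaw k).map_eq]

theorem mainTheorem2 {d : ℕ} {Ω : Type*} [MeasurableSpace Ω] (P : Measure Ω)
    [IsProbabilityMeasure P] (B : ℝ≥0 → Ω → ℝ) (hB : IsBrownianReal B P)
    (f g : EuclideanSpace ℝ (Fin d) → EuclideanSpace ℝ (Fin d)) (hf : Continuous f)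
    (θ : ℝ) (hθ : θ ∈ Set.Icc (1 / 2 : ℝ) 1) (h : ℝ≥0) (hh : 0 < h)
    (K₁ K₂ μ a σ b : ℝ) (hK₁ : 0 < K₁) (hK₂ : K₂ < 0) (hK : 2 * K₂ + K₁ < 0)
    (hμ : μ < 0) (ha : 0 < a) (hσ : 0 < σ) (hb : 0 < b) (hμσ : 2 * μ + σ < 0)
    (hg_lip : ∀ x y, ‖g x - g y‖ ^ 2 ≤ K₁ * ‖x - y‖ ^ 2)
    (hf_mono : ∀ x y, inner ℝ (x - y) (f x - f y) ≤ K₂ * ‖x - y‖ ^ 2)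
    (hf_diss : ∀ x, inner ℝ x (f x) ≤ μ * ‖x‖ ^ 2 + a)
    (hg_growth : ∀ x, ‖g x‖ ^ 2 ≤ σ * ‖x‖ ^ 2 + b) :
    (∀ x₀ : EuclideanSpace ℝ (Fin d), ∃ X : ℕ → Ω → EuclideanSpace ℝ (Fin d),
      (∀ k, Measurable (X k)) ∧ IsThetaScheme P B f g θ h x₀ X ∧
        ∀ Y : ℕ → Ω → EuclideanSpace ℝ (Fin d), IsThetaScheme P B f g θ h x₀ Y →
          ∀ᵐ ω ∂P, ∀ k, Y k ω = X k ω) ∧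
    ∃! π : ProbabilityMeasure (EuclideanSpace ℝ (Fin d)),
      IsStationaryDistribution P B f g θ h π := by
  obtain ⟨Z, hZ, hZi, hZlaw, hZB⟩ := exists_noise_of_isBrownianReal hB h
  have hh0 : (0 : ℝ) < h := hh
  have hθ0 : 0 ≤ θ * h := mul_nonneg (by linarith [hθ.1]) hh0.le
  have hgc : Continuous g := (LipschitzWith.of_dist_le_mul (K := (√K₁).toNNReal) fun x y => by
    rw [Real.coe_toNNReal _ (Real.sqrt_nonneg _), dist_eq_norm, dist_eq_norm]
    refine abs_le_of_sq_le_sq' ?_ (by positivity) |>.2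
    rw [mul_pow, Real.sq_sqrt hK₁.le]
    exact hg_lip x y).continuous
  obtain ⟨e, he⟩ := exists_homeomorph_of_strongly_monotone
    (G := fun x => x - (θ * (h : ℝ)) • f x) (by fun_prop) (fun x y => by
      have : x - (θ * (h : ℝ)) • f x - (y - (θ * (h : ℝ)) • f y) =
        (x - y) - (θ * (h : ℝ)) • (f x - f y) := by module
      rw [this, inner_sub_right, inner_smul_right, real_inner_self_eq_norm_sq]
      nlinarith [mul_le_mul_of_nonneg_left (hf_mono x y) hθ0,
        mul_nonneg hθ0 (mul_nonneg (neg_nonneg.2 hK₂.le) (sq_nonneg ‖x - y‖))])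
  -- the implicit step, solved for the new state
  let T : EuclideanSpace ℝ (Fin d) → ℝ → EuclideanSpace ℝ (Fin d) := fun x z =>
    e.symm (x + ((1 - θ) * (h : ℝ)) • f x + z • g x)
  have hT : Continuous (Function.uncurry T) := e.symm.continuous.comp (by fun_prop)
  have heT : ∀ x z, e (T x z) = x + ((1 - θ) * (h : ℝ)) • f x + z • g x := fun x z =>
    e.apply_symm_apply _
  -- the equation of the scheme is the explicit recursion `x' = T x z`
  have hstep : ∀ x z x', x' = T x z ↔
      x' = x + (θ * (h : ℝ)) • f x' + ((1 - θ) * (h : ℝ)) • f x + z • g x := by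
    intro x z x'
    rw [← e.injective.eq_iff, heT, he, sub_eq_iff_eq_add]
    constructor <;> intro H <;> refine H.trans ?_ <;> abel
  have hscheme : ∀ (x₀ : EuclideanSpace ℝ (Fin d)) (X : ℕ → Ω → EuclideanSpace ℝ (Fin d)),
      IsThetaScheme P B f g θ h x₀ X ↔
        ∀ᵐ ω ∂P, ∀ k, X k ω = randIter T (fun i => Z i ω) x₀ k := by
    intro x₀ X
    refine eventually_congr (hZB.mono fun ω hω => ?_)
    simp_rw [hω, ← hstep]
    constructor
    · rintro ⟨h0, h1⟩ k
      induction k with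
      | zero => exact h0
      | succ k ih => rw [h1, ih, randIter_succ]
    · intro H
      exact ⟨H 0, fun k => by rw [H (k + 1), H k, randIter_succ]⟩
  have hTx := fun x₀ k => measurable_randIter hT.measurable hZ x₀ k
  have hsol : ∀ x₀, IsThetaScheme P B f g θ h x₀
      fun k ω => randIter T (fun i => Z i ω) x₀ k := fun x₀ =>
    (hscheme x₀ _).2 (ae_of_all _ fun _ _ => rfl)
  refine ⟨fun x₀ => ⟨fun k ω => randIter T (fun i => Z i ω) x₀ k, hTx x₀, hsol x₀,
    fun Y hY => (hscheme x₀ Y).1 hY⟩, ?_⟩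
  obtain ⟨π, hπ⟩ := exists_tendsto_distL_randIter hT hZ hZi hZlaw e.continuous
    (κ := h * (-(2 * μ + σ))) (κ' := h * (-(2 * K₂ + K₁))) (c := h * (2 * a + b))
    (mul_pos hh0 (by linarith)) (mul_pos hh0 (by linarith))
    (fun x => by
      simp_rw [heT, he]
      exact lintegral_norm_sq_step_add_le hθ.1 h hμσ.le (by positivity) (hf_diss x) (hg_growth x))
    (fun x y => by
      have := lintegral_norm_sq_step_add_le hθ.1 h (u := x - y) (e := f x - f y) (v := g x - g y)
        (p := 0) (q := 0) hK.le (by norm_num) (by simpa using hf_mono x y)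
        (by simpa using hg_lip x y)
      simp only [mul_zero, add_zero, ENNReal.ofReal_zero] at this
      have h1 : ∀ z : ℝ, x + ((1 - θ) * (h : ℝ)) • f x + z • g x -
          (y + ((1 - θ) * (h : ℝ)) • f y + z • g y) =
          x - y + ((1 - θ) * (h : ℝ)) • (f x - f y) + z • (g x - g y) := fun z => by module
      have h2 : x - (θ * (h : ℝ)) • f x - (y - (θ * (h : ℝ)) • f y) =
          x - y - (θ * (h : ℝ)) • (f x - f y) := by module
      simp_rw [heT, he, h1, h2]
      exact this)
  refine ⟨π, fun x₀ X hX => ?_, fun π' hπ' => ?_⟩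
  · refine (hπ x₀).congr fun k => ?_
    rw [Measure.map_congr (((hscheme x₀ X).1 hX).mono fun ω hω => hω k)]
  · have := fun k => Measure.isProbabilityMeasure_map (μ := P) (hTx 0 k).aemeasurable
    exact eq_of_tendsto_distL (hπ' 0 _ (hsol 0)) (hπ 0)
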